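/- A rooted transition system $M$ consists of a set $S_M$ of states (finite or infinite), a binary transition relation $\to$ on $S_M$ and an initial state $\star_M\in S_M$. A simulation $f\colon M\to N$ is a function $S_M\to S_N$ preserving transitions and the initial state; rooted transition systems and simulations form a category. Write $\to^*$ for the reflexive transitive closure of $\to$. States $s,t$ of $M$ are path-equivalent, $s\sim_M t$, if for all $u\in S_M$ we have $s\to^* u\Leftrightarrow t\to^* u$ and $u\to^* s\Leftrightarrow u\to^* t$. The path-equivalence quotient $M/{\sim}$ has states $S_M/{\sim_M}$, a transition $[s_1]\to[s_2]$ whenever $s_1'\to s_2'$ for some $s_1'\sim_M s_1$ and $s_2'\sim_M s_2$, and initial state $[\star_M]$. A functional bisimulation between $M$ and $N$ is a pair of simulations $f\colon M\to N$, $g\colon N\to M$ with $gf(s)\sim_M s$ for all $s\in S_M$ and $fg(t)\sim_N t$ for all $t\in S_N$; $M$ and $N$ are functionally bisimilar if such a pair exists. The geometric theory $\mathrm{Th}(M)$ has one sort, a constant $c_s$ for each $s\in S_M$ (the constant $c_{\star_M}$ being the distinguished constant for the initial state), and binary relation symbols $\Delta$ (transition), $\Gamma$ (reachability), $\Theta$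 (path equivalence). Its axioms are $\Delta(x,y)\vdash\Gamma(x,y)$; $\top\vdash\Gamma(x,x)$; $\Gamma(x,y)\wedge\Gamma(y,z)\vdash\Gamma(x,z)$; $\Gamma(x,y)\wedge\Gamma(y,x)\vdash\Theta(x,y)$; $\Theta(x,y)\vdash\Theta(y,x)$; $\Theta(x,y)\vdash\Gamma(x,y)$; and $\top\vdash\Delta(c_s,c_t)$ whenever $s\to t$; $\Delta(c_s,x)\vdash\bigvee_{t:\,s\to t}x=c_t$ for each $s$; $\Gamma(c_s,c_t)\vdash\bot$ whenever $s\not\to^* t$; $\Theta(c_s,c_t)\vdash\bot$ whenever $s\not\sim_M t$; and $\top\vdash\bigvee_{s\in S_M}x=c_s$. (Disjunctions may be infinite.) The classifying topos $\mathcal E[M]$ is the classifying topos of $\mathrm{Th}(M)$, i.e. the category of sheaves of sets on the syntactic category of $\mathrm{Th}(M)$ (objects: geometric formulas in context; morphisms: provably functional geometric formulas modulo provable equivalence) for the topology generated by the small families $\theta_i\colon\{x_i.\,\varphi_i\}\to\{y.\,\psi\}$ such that $\psi\vdash_y\bigvee_i\exists x_i\,\theta_i(x_i,y)$ is provable in $\mathrm{Th}(M)$.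 **Theorem (Quotient Bridge).** Let $M$ and $N$ be rooted transition systems. If $M$ and $N$ are functionally bisimilar, then $M/{\sim}\cong N/{\sim}$ as rooted transition systems, and $\mathcal E[M/{\sim}]\simeq\mathcal E[N/{\sim}]$. -/

import Mathlib

open CategoryTheory

universe u

/-! ## Geometric logic over a one-sorted first-order language -/

namespace Geometric

open FirstOrder.Language (Term)

/-- Geometric formulas over `L` whose free variables are taken from `α`: equations, atomic
relations, `⊤`, binary conjunction, disjunction indexed by an arbitrary (small) set, and
existential quantification over a finite tuple of variables. In `ex k φ` the variables `Sum.inr i`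
of `φ` are bound. -/
inductive Formula (L : FirstOrder.Language.{u, u}) : Type → Type (u + 1)
  | eq {α : Type} (s t : L.Term α) : Formula L α
  | rel {α : Type} {k : ℕ} (R : L.Relations k) (ts : Fin k → L.Term α) : Formula L α
  | top {α : Type} : Formula L α
  | and {α : Type} (φ ψ : Formula L α) : Formula L α
  | iSup {α : Type} {ι : Type u} (φ : ι → Formula L α) : Formula L α
  | ex {α : Type} (k : ℕ) (φ : Formula L (α ⊕ Fin k)) : Formula L α

variable {L : FirstOrder.Language.{u, u}} {α β γ : Type}

/-- The free variable `a` as a term. -/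
abbrev v (a : α) : L.Term α := Term.var a

/-- The substitution `σ` carried under a binder of `k` variables. -/
def lift (k : ℕ) (σ : α → L.Term β) : α ⊕ Fin k → L.Term (β ⊕ Fin k) :=
  Sum.elim (fun a => (σ a).subst (fun b => v (Sum.inl b))) (fun i => v (Sum.inr i))

namespace Formula

/-- Falsity, the empty disjunction. -/
def bot : Formula L α := iSup (ι := PEmpty) (fun i => i.elim)

/-- Conjunction of a finite tuple of formulas. -/
def conj : {n : ℕ} → (Fin n → Formula L α) → Formula L α
  | 0, _ => top
  | _ + 1, φ => and (φ 0) (conj (fun i => φ i.succ))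

/-- Simultaneous (capture-avoiding) substitution of terms for the free variables. -/
def subst : {α β : Type} → Formula L α → (α → L.Term β) → Formula L β
  | _, _, eq s t, σ => eq (s.subst σ) (t.subst σ)
  | _, _, rel R ts, σ => rel R (fun i => (ts i).subst σ)
  | _, _, top, _ => top
  | _, _, and φ ψ, σ => and (φ.subst σ) (ψ.subst σ)
  | _, _, iSup φ, σ => iSup (fun i => (φ i).subst σ)
  | _, _, ex k φ, σ => ex k (φ.subst (lift k σ))

/-- Weakening of the context by `k` variables. -/
def wk (k : ℕ) (φ : Formula L α) : Formula L (α ⊕ Fin k) :=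
  φ.subst (fun a => v (Sum.inl a))

/-- Instantiation of the last `k` variables. -/
def inst {k : ℕ} (φ : Formula L (α ⊕ Fin k)) (ts : Fin k → L.Term α) : Formula L α :=
  φ.subst (Sum.elim v ts)

end Formula

/-- A geometric sequent `hyp ⊢ concl` in a context of `ctx` variables. -/
structure Sequent (L : FirstOrder.Language.{u, u}) where
  ctx : ℕ
  hyp : Formula L (Fin ctx)
  concl : Formula L (Fin ctx)

/-- A geometric theory: a set of geometric sequents. -/
abbrev GeomTheory (L : FirstOrder.Language.{u, u}) := Set (Sequent L)

open Formula in
/-- `Prf T Γ φ`: from the finite list of hypotheses `Γ`, all in the context `α`, the formula `φ` is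
derivable in geometric logic from the theory `T`. This is the natural-deduction presentation of
infinitary geometric logic; in particular contexts are tracked, so no element is ever assumed
to exist. -/
inductive Prf (T : GeomTheory L) : {α : Type} → List (Formula L α) → Formula L α → Prop
  | hyp {α : Type} {Γ : List (Formula L α)} {φ : Formula L α} : φ ∈ Γ → Prf T Γ φ
  | ax {α : Type} {Γ : List (Formula L α)} {S : Sequent L} (hS : S ∈ T) (σ : Fin S.ctx → L.Term α) :
      Prf T Γ (S.hyp.subst σ) → Prf T Γ (S.concl.subst σ)
  | topI {α : Type} {Γ : List (Formula L α)} : Prf T Γ top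
  | andI {α : Type} {Γ : List (Formula L α)} {φ ψ : Formula L α} :
      Prf T Γ φ → Prf T Γ ψ → Prf T Γ (and φ ψ)
  | andL {α : Type} {Γ : List (Formula L α)} {φ ψ : Formula L α} : Prf T Γ (and φ ψ) → Prf T Γ φ
  | andR {α : Type} {Γ : List (Formula L α)} {φ ψ : Formula L α} : Prf T Γ (and φ ψ) → Prf T Γ ψ
  | supI {α : Type} {Γ : List (Formula L α)} {ι : Type u} {φ : ι → Formula L α} (i : ι) :
      Prf T Γ (φ i) → Prf T Γ (iSup φ)
  | supE {α : Type} {Γ : List (Formula L α)} {ι : Type u} {φ : ι → Formula L α}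
      {ψ : Formula L α} :
      Prf T Γ (iSup φ) → (∀ i, Prf T (φ i :: Γ) ψ) → Prf T Γ ψ
  | exI {α : Type} {Γ : List (Formula L α)} {k : ℕ} {φ : Formula L (α ⊕ Fin k)}
      (ts : Fin k → L.Term α) : Prf T Γ (φ.inst ts) → Prf T Γ (ex k φ)
  | exE {α : Type} {Γ : List (Formula L α)} {k : ℕ} {φ : Formula L (α ⊕ Fin k)}
      {ψ : Formula L α} :
      Prf T Γ (ex k φ) → Prf T (φ :: Γ.map (wk k)) (ψ.wk k) → Prf T Γ ψ
  | eqI {α : Type} {Γ : List (Formula L α)} (t : L.Term α) : Prf T Γ (eq t t)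
  | eqE {α : Type} {Γ : List (Formula L α)} {k : ℕ} (φ : Formula L (α ⊕ Fin k))
      {s t : Fin k → L.Term α} :
      (∀ i, Prf T Γ (eq (s i) (t i))) → Prf T Γ (φ.inst s) → Prf T Γ (φ.inst t)

/-! ### Substitution, weakening and cut -/

theorem term_subst_v (t : L.Term α) : t.subst v = t := by
  induction t with
  | var a => rfl
  | func f ts ih => simp only [Term.subst, ih]

theorem term_subst_subst (t : L.Term α) (σ : α → L.Term β) (τ : β → L.Term γ) :
    (t.subst σ).subst τ = t.subst (fun a => (σ a).subst τ) := by
  induction t with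
  | var a => rfl
  | func f ts ih => simp only [Term.subst, ih]

theorem lift_v (k : ℕ) : lift (L := L) k (v : α → L.Term α) = v := by
  funext a; cases a <;> rfl

theorem lift_comp (k : ℕ) (σ : α → L.Term β) (τ : β → L.Term γ) :
    (fun a => (lift k σ a).subst (lift k τ)) = lift k (fun a => (σ a).subst τ) := by
  funext a
  cases a with
  | inl a => simp only [lift, Sum.elim_inl, term_subst_subst]; rfl
  | inr i => rfl

theorem subst_v (φ : Formula L α) : φ.subst v = φ := by
  induction φ with
  | eq s t => simp only [Formula.subst, term_subst_v]
  | rel R ts => simp only [Formula.subst, term_subst_v]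
  | top => rfl
  | and φ ψ h1 h2 => simp only [Formula.subst, h1, h2]
  | iSup φ h => simp only [Formula.subst, h]
  | ex k φ h => simp only [Formula.subst, lift_v, h]

theorem subst_subst (φ : Formula L α) (σ : α → L.Term β) (τ : β → L.Term γ) :
    (φ.subst σ).subst τ = φ.subst (fun a => (σ a).subst τ) := by
  induction φ generalizing β γ with
  | eq s t => simp only [Formula.subst, term_subst_subst]
  | rel R ts => simp only [Formula.subst, term_subst_subst]
  | top => rfl
  | and φ ψ h1 h2 => simp only [Formula.subst, h1, h2]
  | iSup φ h => simp only [Formula.subst, h]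
  | ex k φ h => simp only [Formula.subst, h, lift_comp]

theorem wk_subst_lift (k : ℕ) (φ : Formula L α) (σ : α → L.Term β) :
    (φ.wk k).subst (lift k σ) = (φ.subst σ).wk k := by
  simp only [Formula.wk, subst_subst]; rfl

theorem inst_subst {k : ℕ} (φ : Formula L (α ⊕ Fin k)) (ts : Fin k → L.Term α)
    (σ : α → L.Term β) :
    (φ.inst ts).subst σ = (φ.subst (lift k σ)).inst (fun i => (ts i).subst σ) := by
  simp only [Formula.inst, subst_subst]
  congr 1
  funext a
  cases a with
  | inl a =>
    simp only [lift, Sum.elim_inl, term_subst_subst]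
    exact (term_subst_v _).symm
  | inr i => rfl

namespace Prf

variable {T : GeomTheory L}

theorem subst {Γ : List (Formula L α)} {φ : Formula L α} (h : Prf T Γ φ) (σ : α → L.Term β) :
    Prf T (Γ.map (fun χ => χ.subst σ)) (φ.subst σ) := by
  induction h generalizing β with
  | hyp h => exact .hyp (List.mem_map_of_mem h)
  | ax hS τ _ ih =>
    have := ih σ
    rw [subst_subst] at this ⊢
    exact .ax hS _ this
  | topI => exact .topI
  | andI _ _ h1 h2 => exact .andI (h1 σ) (h2 σ)
  | andL _ h => exact .andL (h σ)
  | andR _ h => exact .andR (h σ)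
  | supI i _ h => exact .supI i (h σ)
  | supE _ _ h1 h2 => exact .supE (h1 σ) (fun i => h2 i σ)
  | exI ts _ h =>
    have := h σ
    rw [inst_subst] at this
    exact .exI _ this
  | @exE _ Γ k φ ψ _ _ h1 h2 =>
    refine .exE (h1 σ) ?_
    have := h2 (lift k σ)
    simpa only [List.map_cons, List.map_map, Function.comp_def, wk_subst_lift] using this
  | eqI t => exact .eqI _
  | eqE φ _ _ h1 h2 =>
    have := h2 σ
    rw [inst_subst] at this ⊢
    exact .eqE _ (fun i => h1 i σ) this

theorem cuts {Γ Γ' : List (Formula L α)} {φ : Formula L α} (h : Prf T Γ φ)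
    (hΓ : ∀ χ ∈ Γ, Prf T Γ' χ) : Prf T Γ' φ := by
  have ext : ∀ {α : Type} {Γ Γ' : List (Formula L α)} (θ : Formula L α),
      (∀ {χ : Formula L α}, Prf T Γ' χ → Prf T (θ :: Γ') χ) →
      (∀ χ ∈ Γ, Prf T Γ' χ) → ∀ χ ∈ θ :: Γ, Prf T (θ :: Γ') χ := by
    intro α Γ Γ' θ hw h χ hχ
    rcases List.mem_cons.1 hχ with rfl | hχ
    · exact .hyp List.mem_cons_self
    · exact hw (h χ hχ)
  have weak : ∀ {α : Type} {Γ : List (Formula L α)} {φ : Formula L α}, Prf T Γ φ →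
      ∀ {Γ' : List (Formula L α)}, Γ ⊆ Γ' → Prf T Γ' φ := by
    intro α Γ φ h
    induction h with
    | hyp h => intro Γ' hs; exact .hyp (hs h)
    | ax hS τ _ ih => intro Γ' hs; exact .ax hS _ (ih hs)
    | topI => intros; exact .topI
    | andI _ _ h1 h2 => intro Γ' hs; exact .andI (h1 hs) (h2 hs)
    | andL _ h => intro Γ' hs; exact .andL (h hs)
    | andR _ h => intro Γ' hs; exact .andR (h hs)
    | supI i _ h => intro Γ' hs; exact .supI i (h hs)
    | supE _ _ h1 h2 =>
      intro Γ' hs; exact .supE (h1 hs) (fun i => h2 i (List.cons_subset_cons _ hs))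
    | exI ts _ h => intro Γ' hs; exact .exI ts (h hs)
    | exE _ _ h1 h2 =>
      intro Γ' hs
      exact .exE (h1 hs) (h2 (List.cons_subset_cons _ (List.map_subset _ hs)))
    | eqI t => intros; exact .eqI _
    | eqE φ _ _ h1 h2 => intro Γ' hs; exact .eqE φ (fun i => h1 i hs) (h2 hs)
  induction h with
  | hyp h => exact hΓ _ h
  | ax hS τ _ ih => exact .ax hS _ (ih hΓ)
  | topI => exact .topI
  | andI _ _ h1 h2 => exact .andI (h1 hΓ) (h2 hΓ)
  | andL _ h => exact .andL (h hΓ)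
  | andR _ h => exact .andR (h hΓ)
  | supI i _ h => exact .supI i (h hΓ)
  | supE _ _ h1 h2 =>
    exact .supE (h1 hΓ) (fun i => h2 i (ext _ (fun h => weak h (List.subset_cons_self _ _)) hΓ))
  | exI ts _ h => exact .exI ts (h hΓ)
  | exE _ _ h1 h2 =>
    refine .exE (h1 hΓ) (h2 (ext _ (fun h => weak h (List.subset_cons_self _ _)) ?_))
    intro χ hχ
    obtain ⟨χ', hχ', rfl⟩ := List.mem_map.1 hχ
    exact (hΓ _ hχ').subst _
  | eqI t => exact .eqI _
  | eqE φ _ _ h1 h2 => exact .eqE φ (fun i => h1 i hΓ) (h2 hΓ)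

theorem mono {Γ Γ' : List (Formula L α)} {φ : Formula L α} (h : Prf T Γ φ) (hs : Γ ⊆ Γ') :
    Prf T Γ' φ :=
  h.cuts (fun _ hχ => .hyp (hs hχ))

/-- Use of a one-hypothesis sequent at a substitution instance. -/
theorem use {Γ : List (Formula L β)} {φ ψ : Formula L α} (h : Prf T [φ] ψ) (σ : α → L.Term β)
    (hφ : Prf T Γ (φ.subst σ)) : Prf T Γ (ψ.subst σ) := by
  refine (h.subst σ).cuts ?_
  intro χ hχ
  rw [List.map_singleton, List.mem_singleton] at hχ
  exact hχ ▸ hφ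

theorem conjI {Γ : List (Formula L α)} {n : ℕ} {φ : Fin n → Formula L α}
    (h : ∀ i, Prf T Γ (φ i)) : Prf T Γ (Formula.conj φ) := by
  induction n with
  | zero => exact .topI
  | succ n ih => exact .andI (h 0) (ih (fun i => h i.succ))

theorem conjE {Γ : List (Formula L α)} {n : ℕ} {φ : Fin n → Formula L α}
    (h : Prf T Γ (Formula.conj φ)) (i : Fin n) : Prf T Γ (φ i) := by
  induction n with
  | zero => exact i.elim0
  | succ n ih =>
    refine Fin.cases ?_ (fun i => ?_) i
    · exact .andL h
    · exact ih (φ := fun i => φ i.succ) (.andR h) i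

theorem eqSymm {Γ : List (Formula L α)} {s t : L.Term α} (h : Prf T Γ (.eq s t)) :
    Prf T Γ (.eq t s) := by
  have := Prf.eqE (T := T) (Γ := Γ) (k := 1)
    (.eq (v (Sum.inr 0)) (s.subst (fun a => v (Sum.inl a)))) (s := fun _ => s) (t := fun _ => t)
    (fun _ => h)
  simp only [Formula.inst, Formula.subst, term_subst_subst, Term.subst, Sum.elim_inl,
    Sum.elim_inr] at this
  rw [show (fun a : α => (v a : L.Term α)) = v from rfl, term_subst_v] at this
  exact this (.eqI s)

theorem eqTrans {Γ : List (Formula L α)} {r s t : L.Term α} (h : Prf T Γ (.eq r s))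
    (h' : Prf T Γ (.eq s t)) : Prf T Γ (.eq r t) := by
  have := Prf.eqE (T := T) (Γ := Γ) (k := 1)
    (.eq (r.subst (fun a => v (Sum.inl a))) (v (Sum.inr 0))) (s := fun _ => s) (t := fun _ => t)
    (fun _ => h')
  simp only [Formula.inst, Formula.subst, term_subst_subst, Term.subst, Sum.elim_inl,
    Sum.elim_inr] at this
  rw [show (fun a : α => (v a : L.Term α)) = v from rfl, term_subst_v] at this
  exact this h

/-- Replacement of equals by equals in the last `k` variables of a formula in context. -/
theorem congrR {Γ : List (Formula L α)} {k : ℕ} (φ : Formula L (β ⊕ Fin k))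
    (a : β → L.Term α) {s t : Fin k → L.Term α} (h : ∀ i, Prf T Γ (.eq (s i) (t i)))
    (hs : Prf T Γ (φ.subst (Sum.elim a s))) : Prf T Γ (φ.subst (Sum.elim a t)) := by
  have key : ∀ r : Fin k → L.Term α,
      (φ.subst (lift k a)).inst r = φ.subst (Sum.elim a r) := by
    intro r
    simp only [Formula.inst, subst_subst]
    congr 1
    funext x
    cases x with
    | inl x =>
      simp only [lift, Sum.elim_inl, term_subst_subst]
      exact term_subst_v _
    | inr i => rfl
  rw [← key] at hs ⊢
  exact .eqE _ h hs

end Prf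

/-! ### The syntactic category -/

/-- An object of the syntactic category: a geometric formula in a finite context. -/
structure SynCat (T : GeomTheory L) where
  ctx : ℕ
  form : Formula L (Fin ctx)

variable {T : GeomTheory L}

/-- `θ(x, y)` is `T`-provably functional from `{x. φ}` to `{y. ψ}`. -/
structure ProvablyFunctional (X Y : SynCat T) (θ : Formula L (Fin X.ctx ⊕ Fin Y.ctx)) : Prop where
  dom : Prf T [θ] (X.form.subst (fun i => v (Sum.inl i)))
  cod : Prf T [θ] (Y.form.subst (fun j => v (Sum.inr j)))
  total : Prf T [X.form] (.ex Y.ctx θ)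
  /-- `θ(x, y) ∧ θ(x, z) ⊢ y = z` in the context `x, y, z` -/
  unique : ∀ j : Fin Y.ctx, Prf T (α := Fin X.ctx ⊕ (Fin Y.ctx ⊕ Fin Y.ctx))
    [θ.subst (Sum.elim (fun i => v (Sum.inl i)) (fun j => v (Sum.inr (Sum.inl j)))),
      θ.subst (Sum.elim (fun i => v (Sum.inl i)) (fun j => v (Sum.inr (Sum.inr j))))]
    (.eq (v (Sum.inr (Sum.inl j))) (v (Sum.inr (Sum.inr j))))

/-- Provably functional formulas. -/
def FunForm (X Y : SynCat T) := {θ : Formula L (Fin X.ctx ⊕ Fin Y.ctx) // ProvablyFunctional X Y θ}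

/-- Two provably functional formulas are identified if they are `T`-provably equivalent. -/
instance FunForm.setoid (X Y : SynCat T) : Setoid (FunForm X Y) where
  r θ θ' := Prf T [θ.1] θ'.1 ∧ Prf T [θ'.1] θ.1
  iseqv :=
    { refl := fun _ => ⟨.hyp List.mem_cons_self, .hyp List.mem_cons_self⟩
      symm := fun h => ⟨h.2, h.1⟩
      trans := fun h h' =>
        ⟨h'.1.cuts (fun _ hχ => List.mem_singleton.1 hχ ▸ h.1),
          h.2.cuts (fun _ hχ => List.mem_singleton.1 hχ ▸ h'.2)⟩ }

/-- The identity formula `φ(x) ∧ x = y`. -/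
def idForm (X : SynCat T) : Formula L (Fin X.ctx ⊕ Fin X.ctx) :=
  .and (X.form.subst (fun i => v (Sum.inl i)))
    (.conj (fun i => .eq (v (Sum.inl i)) (v (Sum.inr i))))

/-- The composite formula `∃ y, θ(x, y) ∧ η(y, z)`. -/
def compForm {n m p : ℕ} (θ : Formula L (Fin n ⊕ Fin m)) (η : Formula L (Fin m ⊕ Fin p)) :
    Formula L (Fin n ⊕ Fin p) :=
  .ex m (.and
    (θ.subst (Sum.elim (fun i => v (Sum.inl (Sum.inl i))) (fun j => v (Sum.inr j))))
    (η.subst (Sum.elim (fun j => v (Sum.inr j)) (fun l => v (Sum.inl (Sum.inr l))))))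

section Calculus

variable {X Y Z : SynCat T} {n m p : ℕ}

/-- The tuple of terms `a` in a context enlarged by `k` variables. -/
def up (k : ℕ) (a : β → L.Term α) : β → L.Term (α ⊕ Fin k) :=
  fun i => (a i).subst (fun x => v (Sum.inl x))

theorem wk_subst (k : ℕ) (φ : Formula L β) (a : β → L.Term α) :
    (φ.subst a).wk k = φ.subst (up k a) := by
  simp only [Formula.wk, subst_subst]; rfl

theorem up_elim (k : ℕ) (a : Fin n → L.Term α) (b : Fin m → L.Term α) :
    up k (Sum.elim a b) = Sum.elim (up k a) (up k b) := by
  funext x; cases x <;> rfl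

theorem eta (θ : Formula L (Fin n ⊕ Fin m)) :
    θ.subst (Sum.elim (fun i => v (Sum.inl i)) (fun j => v (Sum.inr j))) = θ := by
  conv_rhs => rw [← subst_v θ]
  congr 1
  funext x; cases x <;> rfl

theorem ProvablyFunctional.dom' {θ : Formula L (Fin X.ctx ⊕ Fin Y.ctx)}
    (hθ : ProvablyFunctional X Y θ) {Γ : List (Formula L α)} {a : Fin X.ctx → L.Term α}
    {b : Fin Y.ctx → L.Term α} (h : Prf T Γ (θ.subst (Sum.elim a b))) :
    Prf T Γ (X.form.subst a) := by
  have := hθ.dom.use _ h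
  rwa [subst_subst] at this

theorem ProvablyFunctional.cod' {θ : Formula L (Fin X.ctx ⊕ Fin Y.ctx)}
    (hθ : ProvablyFunctional X Y θ) {Γ : List (Formula L α)} {a : Fin X.ctx → L.Term α}
    {b : Fin Y.ctx → L.Term α} (h : Prf T Γ (θ.subst (Sum.elim a b))) :
    Prf T Γ (Y.form.subst b) := by
  have := hθ.cod.use _ h
  rwa [subst_subst] at this

theorem ProvablyFunctional.total' {θ : Formula L (Fin X.ctx ⊕ Fin Y.ctx)}
    (hθ : ProvablyFunctional X Y θ) {Γ : List (Formula L α)} {a : Fin X.ctx → L.Term α}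
    {χ : Formula L α} (h : Prf T Γ (X.form.subst a))
    (hχ : Prf T (θ.subst (Sum.elim (up Y.ctx a) (fun j => v (Sum.inr j))) ::
      Γ.map (Formula.wk Y.ctx)) (χ.wk Y.ctx)) : Prf T Γ χ :=
  .exE (hθ.total.use _ h) hχ

theorem ProvablyFunctional.unique' {θ : Formula L (Fin X.ctx ⊕ Fin Y.ctx)}
    (hθ : ProvablyFunctional X Y θ) {Γ : List (Formula L α)} {a : Fin X.ctx → L.Term α}
    {b c : Fin Y.ctx → L.Term α} (h : Prf T Γ (θ.subst (Sum.elim a b)))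
    (h' : Prf T Γ (θ.subst (Sum.elim a c))) (j : Fin Y.ctx) : Prf T Γ (.eq (b j) (c j)) := by
  refine ((hθ.unique j).subst (Sum.elim a (Sum.elim b c))).cuts ?_
  intro χ hχ
  simp only [List.map_cons, List.map_nil, List.mem_cons, List.not_mem_nil, or_false,
    subst_subst] at hχ
  rcases hχ with rfl | rfl
  · convert h using 2
    funext x; cases x <;> rfl
  · convert h' using 2
    funext x; cases x <;> rfl

theorem compForm_subst (θ : Formula L (Fin n ⊕ Fin m)) (η : Formula L (Fin m ⊕ Fin p))
    (a : Fin n → L.Term α) (c : Fin p → L.Term α) :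
    (compForm θ η).subst (Sum.elim a c) = .ex m (.and
      (θ.subst (Sum.elim (up m a) (fun j => v (Sum.inr j))))
      (η.subst (Sum.elim (fun j => v (Sum.inr j)) (up m c)))) := by
  simp only [compForm, Formula.subst, subst_subst]
  congr 3 <;> · funext x; cases x <;> rfl

theorem compI {θ : Formula L (Fin n ⊕ Fin m)} {η : Formula L (Fin m ⊕ Fin p)}
    {Γ : List (Formula L α)} {a : Fin n → L.Term α} (b : Fin m → L.Term α)
    {c : Fin p → L.Term α} (h : Prf T Γ (θ.subst (Sum.elim a b)))
    (h' : Prf T Γ (η.subst (Sum.elim b c))) :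
    Prf T Γ ((compForm θ η).subst (Sum.elim a c)) := by
  have aux : ∀ {q : ℕ} (d : Fin q → L.Term α) (i : Fin q),
      (up m d i).subst (Sum.elim v b) = d i := by
    intro q d i
    simp only [up, term_subst_subst, Term.subst, Sum.elim_inl]
    exact term_subst_v _
  rw [compForm_subst]
  refine .exI b ?_
  simp only [Formula.inst, Formula.subst, subst_subst]
  refine .andI ?_ ?_
  · convert h using 2
    funext x
    cases x with
    | inl x => exact aux a x
    | inr x => rfl
  · convert h' using 2
    funext x
    cases x with
    | inl x => rfl
    | inr x => exact aux c x

theorem compE {θ : Formula L (Fin n ⊕ Fin m)} {η : Formula L (Fin m ⊕ Fin p)}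
    {Γ : List (Formula L α)} {a : Fin n → L.Term α}
    {c : Fin p → L.Term α} {χ : Formula L α}
    (h : Prf T Γ ((compForm θ η).subst (Sum.elim a c)))
    (hχ : Prf T (θ.subst (Sum.elim (up m a) (fun j => v (Sum.inr j))) ::
      η.subst (Sum.elim (fun j => v (Sum.inr j)) (up m c)) :: Γ.map (Formula.wk m)) (χ.wk m)) :
    Prf T Γ χ := by
  rw [compForm_subst] at h
  refine .exE h (hχ.cuts ?_)
  intro ξ hξ
  rcases List.mem_cons.1 hξ with rfl | hξ
  · exact .andL (.hyp List.mem_cons_self)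
  rcases List.mem_cons.1 hξ with rfl | hξ
  · exact .andR (.hyp List.mem_cons_self)
  · exact .hyp (List.mem_cons_of_mem _ hξ)

theorem idI {Γ : List (Formula L α)} {a b : Fin X.ctx → L.Term α}
    (h : Prf T Γ (X.form.subst a)) (h' : ∀ i, Prf T Γ (.eq (a i) (b i))) :
    Prf T Γ ((idForm X).subst (Sum.elim a b)) := by
  simp only [idForm, Formula.subst, subst_subst]
  refine .andI h ?_
  have key : ∀ {q : ℕ} (φ : Fin q → Formula L (Fin X.ctx ⊕ Fin X.ctx)),
      (Formula.conj φ).subst (Sum.elim a b) = .conj (fun i => (φ i).subst (Sum.elim a b)) := by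
    intro q
    induction q with
    | zero => intro φ; rfl
    | succ q ih => intro φ; simp only [Formula.conj, Formula.subst, ih]
  rw [key]
  exact .conjI h'

theorem idE {Γ : List (Formula L α)} {a b : Fin X.ctx → L.Term α}
    (h : Prf T Γ ((idForm X).subst (Sum.elim a b))) :
    Prf T Γ (X.form.subst a) ∧ ∀ i, Prf T Γ (.eq (a i) (b i)) := by
  have h1 : Prf T [idForm X] (X.form.subst (fun i => v (Sum.inl i))) :=
    .andL (.hyp List.mem_cons_self)
  have h2 : ∀ i, Prf T [idForm X] (.eq (v (Sum.inl i)) (v (Sum.inr i))) :=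
    fun i => .conjE (.andR (.hyp List.mem_cons_self)) i
  refine ⟨?_, fun i => (h2 i).use _ h⟩
  have := h1.use _ h
  rwa [subst_subst] at this

/-- To derive `[θ] ⊢ θ'` it suffices to argue about generic tuples. -/
theorem generic {θ θ' : Formula L (Fin n ⊕ Fin m)}
    (h : ∀ {α : Type} {Γ : List (Formula L α)} {a : Fin n → L.Term α} {b : Fin m → L.Term α},
      Prf T Γ (θ.subst (Sum.elim a b)) → Prf T Γ (θ'.subst (Sum.elim a b))) : Prf T [θ] θ' := by
  have := h (Γ := [θ]) (a := fun i => v (Sum.inl i)) (b := fun j => v (Sum.inr j))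
  rw [eta, eta] at this
  exact this (.hyp List.mem_cons_self)

theorem h0 {Γ : List (Formula L α)} {φ : Formula L α} : Prf T (φ :: Γ) φ :=
  .hyp List.mem_cons_self

theorem h1 {Γ : List (Formula L α)} {φ ψ : Formula L α} : Prf T (ψ :: φ :: Γ) φ :=
  .hyp (List.mem_cons_of_mem _ List.mem_cons_self)

theorem h2 {Γ : List (Formula L α)} {φ ψ ξ : Formula L α} : Prf T (ψ :: ξ :: φ :: Γ) φ :=
  .hyp (List.mem_cons_of_mem _ (List.mem_cons_of_mem _ List.mem_cons_self))

theorem h3 {Γ : List (Formula L α)} {φ ψ ξ ζ : Formula L α} :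
    Prf T (ψ :: ξ :: ζ :: φ :: Γ) φ :=
  .hyp (List.mem_cons_of_mem _ (List.mem_cons_of_mem _ (List.mem_cons_of_mem _
    List.mem_cons_self)))

theorem congrL {Γ : List (Formula L α)} {k : ℕ} (φ : Formula L (Fin k ⊕ β))
    (a : β → L.Term α) {s t : Fin k → L.Term α} (h : ∀ i, Prf T Γ (.eq (s i) (t i)))
    (hs : Prf T Γ (φ.subst (Sum.elim s a))) : Prf T Γ (φ.subst (Sum.elim t a)) := by
  have key : ∀ r : Fin k → L.Term α,
      (φ.subst (Sum.elim (fun i => v (Sum.inr i)) (fun b => v (Sum.inl b)))).subst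
        (Sum.elim a r) = φ.subst (Sum.elim r a) := by
    intro r
    rw [subst_subst]
    congr 1
    funext x; cases x <;> rfl
  rw [← key] at hs ⊢
  exact Prf.congrR _ a h hs

theorem ProvablyFunctional.comp_unique {θ : Formula L (Fin X.ctx ⊕ Fin Y.ctx)}
    {η : Formula L (Fin Y.ctx ⊕ Fin Z.ctx)} (hη : ProvablyFunctional Y Z η)
    (hθ : ProvablyFunctional X Y θ) {Γ : List (Formula L α)} {a : Fin X.ctx → L.Term α}
    {b b' : Fin Y.ctx → L.Term α} {c c' : Fin Z.ctx → L.Term α}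
    (h1 : Prf T Γ (θ.subst (Sum.elim a b))) (h2 : Prf T Γ (η.subst (Sum.elim b c)))
    (h3 : Prf T Γ (θ.subst (Sum.elim a b'))) (h4 : Prf T Γ (η.subst (Sum.elim b' c')))
    (j : Fin Z.ctx) : Prf T Γ (.eq (c j) (c' j)) :=
  hη.unique' h2 (congrL η c' (hθ.unique' h3 h1) h4) j

theorem wk1 {Γ : List (Formula L α)} {φ : Formula L β} {a : β → L.Term α} {k : ℕ}
    {ψ : Formula L (α ⊕ Fin k)} (h : Prf T Γ (φ.subst a)) :
    Prf T (ψ :: Γ.map (Formula.wk k)) (φ.subst (up k a)) := by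
  rw [← wk_subst]
  exact (h.subst _).mono (List.subset_cons_self _ _)

theorem wk2 {Γ : List (Formula L α)} {φ : Formula L β} {a : β → L.Term α} {k : ℕ}
    {ψ ψ' : Formula L (α ⊕ Fin k)} (h : Prf T Γ (φ.subst a)) :
    Prf T (ψ' :: ψ :: Γ.map (Formula.wk k)) (φ.subst (up k a)) :=
  (wk1 h).mono (List.subset_cons_self _ _)

theorem idForm_functional (X : SynCat T) : ProvablyFunctional X X (idForm X) where
  dom := .andL h0
  cod := by
    have h := idE (T := T) (X := X) (Γ := [idForm X]) (a := fun i => v (Sum.inl i))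
      (b := fun j => v (Sum.inr j)) (by rw [eta]; exact h0)
    have key := Prf.congrR (T := T) (Γ := [idForm X])
      (X.form.subst (fun i => v (Sum.inr i)) : Formula L (Empty ⊕ Fin X.ctx))
      (fun e => e.elim) h.2
    simp only [subst_subst] at key
    exact key h.1
  total := by
    refine .exI v ?_
    refine idI (T := T) (X := X) (a := v) (b := v) ?_ (fun i => .eqI _)
    rw [subst_v]
    exact h0
  unique := fun j => (((idE h0).2 j).eqSymm).eqTrans ((idE h1).2 j)

theorem compForm_functional {θ : Formula L (Fin X.ctx ⊕ Fin Y.ctx)}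
    {η : Formula L (Fin Y.ctx ⊕ Fin Z.ctx)} (hθ : ProvablyFunctional X Y θ)
    (hη : ProvablyFunctional Y Z η) : ProvablyFunctional X Z (compForm θ η) where
  dom := by
    refine compE (T := T) (θ := θ) (η := η) (a := fun i => v (Sum.inl i))
      (c := fun j => v (Sum.inr j)) (by rw [eta]; exact h0) ?_
    rw [wk_subst]
    exact hθ.dom' h0
  cod := by
    refine compE (T := T) (θ := θ) (η := η) (a := fun i => v (Sum.inl i))
      (c := fun j => v (Sum.inr j)) (by rw [eta]; exact h0) ?_
    rw [wk_subst]
    exact hη.cod' h1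
  total := by
    refine hθ.total' (T := T) (a := v) (by rw [subst_v]; exact h0) ?_
    refine hη.total' (T := T) (a := fun j => v (Sum.inr j)) (hθ.cod' h0) ?_
    have key : Prf T _ ((compForm θ η).subst (Sum.elim (up Z.ctx (up Y.ctx v))
        (fun l => v (Sum.inr l)))) :=
      compI (T := T) (θ := θ) (η := η) (up Z.ctx (fun j => v (Sum.inr j)))
        (by
          have := wk1 (T := T) (ψ := η.subst (Sum.elim (up Z.ctx (fun j => v (Sum.inr j)))
            (fun j => v (Sum.inr j)))) (h0 (T := T)
            (φ := θ.subst (Sum.elim (up Y.ctx v) (fun j => v (Sum.inr j))))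
            (Γ := [X.form].map (Formula.wk Y.ctx)))
          rwa [up_elim] at this) h0
    refine .exI (fun l => v (Sum.inr l)) ?_
    simp only [Formula.inst, subst_subst]
    convert key using 2
    funext x; cases x <;> rfl
  unique := fun j => by
    refine compE (T := T) (θ := θ) (η := η) h0 ?_
    refine compE (T := T) (θ := θ) (η := η)
      (a := up Y.ctx (fun i => v (Sum.inl i)))
      (c := up Y.ctx (fun j => v (Sum.inr (Sum.inr j)))) ?_ ?_
    · rw [← up_elim]
      exact wk2 h1
    · simp only [List.map_cons, wk_subst, up_elim]
      exact hη.comp_unique hθ h2 h3 h0 h1 j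

/-- Composition of provably functional formulas. -/
def FunForm.comp (θ : FunForm X Y) (η : FunForm Y Z) : FunForm X Z :=
  ⟨compForm θ.1 η.1, compForm_functional θ.2 η.2⟩

theorem use' {θ θ' : Formula L (Fin n ⊕ Fin m)} (h : Prf T [θ] θ') {Γ : List (Formula L α)}
    {a : Fin n → L.Term α} {b : Fin m → L.Term α} (hΓ : Prf T Γ (θ.subst (Sum.elim a b))) :
    Prf T Γ (θ'.subst (Sum.elim a b)) := h.use _ hΓ

theorem comp_mono {θ θ' : Formula L (Fin n ⊕ Fin m)} {η η' : Formula L (Fin m ⊕ Fin p)}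
    (h : Prf T [θ] θ') (h' : Prf T [η] η') : Prf T [compForm θ η] (compForm θ' η') := by
  refine generic fun hc => compE hc ?_
  rw [wk_subst, up_elim]
  exact compI _ (use' h h0) (use' h' h1)

theorem FunForm.comp_rel ⦃θ θ' : FunForm X Y⦄ (h : θ ≈ θ') ⦃η η' : FunForm Y Z⦄ (h' : η ≈ η') :
    θ.comp η ≈ θ'.comp η' :=
  ⟨comp_mono h.1 h'.1, comp_mono h.2 h'.2⟩

theorem id_comp_le (θ : FunForm X Y) : Prf T [compForm (idForm X) θ.1] θ.1 := by
  refine generic fun hc => compE hc ?_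
  rw [wk_subst, up_elim]
  exact congrL _ _ (fun i => ((idE h0).2 i).eqSymm) h1

theorem le_id_comp (θ : FunForm X Y) : Prf T [θ.1] (compForm (idForm X) θ.1) :=
  generic fun h => compI _ (idI (θ.2.dom' h) (fun _ => .eqI _)) h

theorem comp_id_le (θ : FunForm X Y) : Prf T [compForm θ.1 (idForm Y)] θ.1 := by
  refine generic fun hc => compE hc ?_
  rw [wk_subst, up_elim]
  exact Prf.congrR _ _ (fun i => (idE h1).2 i) h0

theorem le_comp_id (θ : FunForm X Y) : Prf T [θ.1] (compForm θ.1 (idForm Y)) :=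
  generic fun h => compI _ h (idI (θ.2.cod' h) (fun _ => .eqI _))

theorem comp_assoc_le {q : ℕ} (θ : Formula L (Fin n ⊕ Fin m)) (η : Formula L (Fin m ⊕ Fin p))
    (ζ : Formula L (Fin p ⊕ Fin q)) :
    Prf T [compForm (compForm θ η) ζ] (compForm θ (compForm η ζ)) := by
  refine generic fun hc => compE hc (compE h0 ?_)
  simp only [List.map_cons, wk_subst, up_elim]
  exact compI _ h0 (compI _ h1 h3)

theorem comp_assoc_ge {q : ℕ} (θ : Formula L (Fin n ⊕ Fin m)) (η : Formula L (Fin m ⊕ Fin p))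
    (ζ : Formula L (Fin p ⊕ Fin q)) :
    Prf T [compForm θ (compForm η ζ)] (compForm (compForm θ η) ζ) := by
  refine generic fun hc => compE hc (compE h1 ?_)
  simp only [List.map_cons, wk_subst, up_elim]
  exact compI _ (compI _ h2 h0) h1

end Calculus

/-- The syntactic category of `T`: formulas in context, and provably functional formulas up to
provable equivalence. -/
instance SynCat.category (T : GeomTheory L) : Category (SynCat T) where
  Hom X Y := Quotient (FunForm.setoid X Y)
  id X := Quotient.mk _ ⟨idForm X, idForm_functional X⟩
  comp f g := Quotient.map₂ FunForm.comp FunForm.comp_rel f g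
  id_comp f := by
    induction f using Quotient.ind with
    | _ θ => exact Quotient.sound ⟨id_comp_le θ, le_id_comp θ⟩
  comp_id f := by
    induction f using Quotient.ind with
    | _ θ => exact Quotient.sound ⟨comp_id_le θ, le_comp_id θ⟩
  assoc f g h := by
    induction f using Quotient.ind with
    | _ θ =>
      induction g using Quotient.ind with
      | _ η =>
        induction h using Quotient.ind with
        | _ ζ => exact Quotient.sound ⟨comp_assoc_le _ _ _, comp_assoc_ge _ _ _⟩

/-- The morphism `X ⟶ Y` represented by a provably functional formula. -/
def FunForm.hom {X Y : SynCat T} (θ : FunForm X Y) : X ⟶ Y := Quotient.mk (FunForm.setoid X Y) θ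

/-- The image `∃ x, θ(x, y)` of a formula `θ(x, y)`. -/
def imageForm {n m : ℕ} (θ : Formula L (Fin n ⊕ Fin m)) : Formula L (Fin m) :=
  .ex n (θ.subst (Sum.elim (fun i => v (Sum.inr i)) (fun j => v (Sum.inl j))))

/-- The provably covering families: small families `θᵢ : {xᵢ. φᵢ} ⟶ {y. ψ}` such that `T` proves
`ψ ⊢ ⋁ᵢ ∃ xᵢ, θᵢ(xᵢ, y)`. -/
def synPrecoverage (T : GeomTheory L) : Precoverage (SynCat T) where
  coverings Y := {R | ∃ (ι : Type u) (X : ι → SynCat T) (θ : ∀ i, FunForm (X i) Y),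
    R = Presieve.ofArrows X (fun i => (θ i).hom) ∧
      Prf T [Y.form] (.iSup (fun i => imageForm (θ i).1))}

/-- The syntactic topology, generated by the provably covering families. -/
def synTopology (T : GeomTheory L) : GrothendieckTopology (SynCat T) :=
  (synPrecoverage T).toGrothendieck

/-- The classifying topos of `T`: sheaves of (small) sets on the syntactic site. The syntactic
category is essentially small, although its objects form a large type. -/
abbrev ClassifyingTopos (T : GeomTheory L) := Sheaf (synTopology T) (Type u)

end Geometric

/-! ## Rooted transition systems -/

/-- A rooted transition system. -/
structure RTS where
  State : Type u
  Step : State → State → Prop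
  init : State

namespace RTS

/-- A simulation: a map of states preserving transitions and the initial state. -/
@[ext]
structure Simulation (M N : RTS.{u}) where
  toFun : M.State → N.State
  map_step : ∀ {s s' : M.State}, M.Step s s' → N.Step (toFun s) (toFun s')
  map_init : toFun M.init = N.init

instance : Category RTS.{u} where
  Hom := Simulation
  id M := ⟨id, fun h => h, rfl⟩
  comp f g := ⟨g.toFun ∘ f.toFun, fun h => g.map_step (f.map_step h), by
    rw [Function.comp_apply, f.map_init, g.map_init]⟩

variable (M N : RTS.{u})

/-- `s →* t`: reachability in zero or more transitions. -/
def Reach (s t : M.State) : Prop := Relation.ReflTransGen M.Step s t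

/-- Path equivalence: the two states reach, and are reached from, the same states. -/
def PathEquiv (s t : M.State) : Prop :=
  ∀ w : M.State, (M.Reach s w ↔ M.Reach t w) ∧ (M.Reach w s ↔ M.Reach w t)

/-- Path equivalence as a setoid. -/
def pathSetoid : Setoid M.State where
  r := M.PathEquiv
  iseqv :=
    { refl := fun _ _ => ⟨Iff.rfl, Iff.rfl⟩
      symm := fun h w => ⟨(h w).1.symm, (h w).2.symm⟩
      trans := fun h h' w => ⟨(h w).1.trans (h' w).1, (h w).2.trans (h' w).2⟩ }

/-- The path-equivalence quotient. There is a transition between two classes whenever there is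
one between some representatives. -/
def quotient : RTS.{u} where
  State := Quotient M.pathSetoid
  Step p q := ∃ s t : M.State, Quotient.mk M.pathSetoid s = p ∧ Quotient.mk M.pathSetoid t = q ∧
    M.Step s t
  init := Quotient.mk M.pathSetoid M.init

/-- A functional bisimulation: simulations in both directions whose composites are the identity
up to path equivalence. -/
structure FunctionalBisimulation where
  f : Simulation M N
  g : Simulation N M
  gf : ∀ s : M.State, M.PathEquiv (g.toFun (f.toFun s)) s
  fg : ∀ t : N.State, N.PathEquiv (f.toFun (g.toFun t)) t

/-- There is a functional bisimulation between the two systems. -/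
def FunctionallyBisimilar : Prop := Nonempty (FunctionalBisimulation M N)

/-! ### The geometric theory of a rooted transition system -/

/-- Function symbols of the rooted transition language: a constant for each state. -/
inductive FuncSym : ℕ → Type u
  | const (s : M.State) : FuncSym 0

/-- Relation symbols of the rooted transition language: transition, reachability and path
equivalence, all binary. -/
inductive RelSym : ℕ → Type u
  | step : RelSym 2
  | reach : RelSym 2
  | pathEq : RelSym 2

/-- The rooted transition language of `M`. -/
def lang : FirstOrder.Language.{u, u} := ⟨M.FuncSym, RelSym⟩

open Geometric

variable {M} {α : Type}

/-- The constant `c_s`; the distinguished constant for the initial state is `cst M.init`. -/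
def cst (s : M.State) : M.lang.Term α :=
  FirstOrder.Language.Term.func (L := M.lang) (l := 0) (FuncSym.const s) Fin.elim0

/-- The atomic formula `Δ(x, y)` (transition). -/
def Δ (x y : M.lang.Term α) : Formula M.lang α :=
  .rel (L := M.lang) (k := 2) RelSym.step ![x, y]

/-- The atomic formula `Γ(x, y)` (reachability). -/
def Γ (x y : M.lang.Term α) : Formula M.lang α :=
  .rel (L := M.lang) (k := 2) RelSym.reach ![x, y]

/-- The atomic formula `Θ(x, y)` (path equivalence). -/
def Θ (x y : M.lang.Term α) : Formula M.lang α :=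
  .rel (L := M.lang) (k := 2) RelSym.pathEq ![x, y]

variable (M)

/-- The geometric theory of a rooted transition system. -/
inductive ThClause : Sequent M.lang → Prop
  -- structural sequents
  | step_reach : ThClause ⟨2, Δ (v 0) (v 1), Γ (v 0) (v 1)⟩
  | reach_refl : ThClause ⟨1, .top, Γ (v 0) (v 0)⟩
  | reach_trans : ThClause ⟨3, .and (Γ (v 0) (v 1)) (Γ (v 1) (v 2)), Γ (v 0) (v 2)⟩
  | pathEq_def : ThClause ⟨2, .and (Γ (v 0) (v 1)) (Γ (v 1) (v 0)), Θ (v 0) (v 1)⟩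
  | pathEq_symm : ThClause ⟨2, Θ (v 0) (v 1), Θ (v 1) (v 0)⟩
  | pathEq_reach : ThClause ⟨2, Θ (v 0) (v 1), Γ (v 0) (v 1)⟩
  -- sequents specific to the system
  | existence (s t : M.State) (h : M.Step s t) : ThClause ⟨0, .top, Δ (cst s) (cst t)⟩
  | completeness (s : M.State) : ThClause ⟨1, Δ (cst s) (v 0),
      .iSup (fun t : {t : M.State // M.Step s t} => .eq (v 0) (cst t.1))⟩
  | not_reach (s t : M.State) (h : ¬ M.Reach s t) : ThClause ⟨0, Γ (cst s) (cst t), .bot⟩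
  | not_pathEq (s t : M.State) (h : ¬ M.PathEquiv s t) : ThClause ⟨0, Θ (cst s) (cst t), .bot⟩
  | domain_closure : ThClause ⟨1, .top, .iSup (fun s : M.State => .eq (v 0) (cst s))⟩

/-- The geometric theory of a rooted transition system, as a set of sequents. -/
def theory : GeomTheory M.lang := {σ | M.ThClause σ}

end RTS

namespace Geometric

variable {L L' : FirstOrder.Language.{u, u}} {α β : Type}

/-! ### Translation of formulas along a language map -/

/-! The argument has two independent halves. On the side of transition systems, path equivalence is
the same as mutual reachability (`pathEquiv_iff`), so every simulation preserves it and descends to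
the quotients. The two conditions on a functional bisimulation say exactly that the descended maps
are mutually inverse, which gives the isomorphism `quotientIso`. Bisimilarity plays no further role.

On the logical side, `Th` is an invariant of isomorphism. An isomorphism of systems renames
constants, and both it and its inverse send axioms to theorems (`interprets_of_iso`). Renaming
symbols commutes with every construction on formulas and preserves proofs (`map_subst`, `Prf.map`),
so it induces functors between the syntactic categories. As the renamings are inverse to each other
symbol by symbol, these functors are inverse on the nose (`mapFunctor_comp_eq_id`). Covering
families are defined by provability of a sequent, so they are preserved in both directions. An
equivalence of categories that preserves generating covers both ways matches the generated
topologies, and so induces an equivalence of sheaf categories. -/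

theorem onTerm_subst (F : L →ᴸ L') (t : L.Term α) (σ : α → L.Term β) :
    F.onTerm (t.subst σ) = (F.onTerm t).subst (fun a => F.onTerm (σ a)) := by
  induction t with
  | var a => rfl
  | func f ts ih =>
    simp only [FirstOrder.Language.Term.subst, FirstOrder.Language.LHom.onTerm, ih]

/-- Translation of a geometric formula along a language map. -/
def Formula.map (F : L →ᴸ L') : {α : Type} → Formula L α → Formula L' α
  | _, .eq s t => .eq (F.onTerm s) (F.onTerm t)
  | _, .rel R ts => .rel (F.onRelation R) (fun i => F.onTerm (ts i))
  | _, .top => .top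
  | _, .and φ ψ => .and (φ.map F) (ψ.map F)
  | _, .iSup φ => .iSup (fun i => (φ i).map F)
  | _, .ex k φ => .ex k (φ.map F)

theorem onTerm_lift (F : L →ᴸ L') (k : ℕ) (σ : α → L.Term β) :
    (fun a => F.onTerm (lift k σ a)) = lift k (fun a => F.onTerm (σ a)) := by
  funext a
  cases a with
  | inl a => exact onTerm_subst F _ _
  | inr i => rfl

theorem onTerm_elim (F : L →ᴸ L') {γ : Type} (a : α → L.Term γ) (b : β → L.Term γ) :
    (fun x => F.onTerm (Sum.elim a b x)) =
      Sum.elim (fun x => F.onTerm (a x)) (fun x => F.onTerm (b x)) := by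
  funext x; cases x <;> rfl

/-- Translation renames symbols and leaves variables and binders alone. All later commutation facts
(weakening, instantiation, identity, composite and image formulas) are instances of this one. -/
theorem map_subst (F : L →ᴸ L') (φ : Formula L α) (σ : α → L.Term β) :
    (φ.subst σ).map F = (φ.map F).subst (fun a => F.onTerm (σ a)) := by
  induction φ generalizing β with
  | eq s t => simp only [Formula.subst, Formula.map, onTerm_subst]
  | rel R ts => simp only [Formula.subst, Formula.map, onTerm_subst]
  | top => rfl
  | and φ ψ h1 h2 => simp only [Formula.subst, Formula.map, h1, h2]
  | iSup φ h => simp only [Formula.subst, Formula.map, h]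
  | ex k φ h => simp only [Formula.subst, Formula.map, h, onTerm_lift]

theorem map_wk (F : L →ᴸ L') (k : ℕ) (φ : Formula L α) :
    (φ.wk k).map F = (φ.map F).wk k :=
  map_subst F _ _

theorem map_inst (F : L →ᴸ L') {k : ℕ} (φ : Formula L (α ⊕ Fin k)) (ts : Fin k → L.Term α) :
    (φ.inst ts).map F = (φ.map F).inst (fun i => F.onTerm (ts i)) := by
  simp only [Formula.inst, map_subst, onTerm_elim]
  rfl

theorem map_conj (F : L →ᴸ L') {n : ℕ} (φ : Fin n → Formula L α) :
    (Formula.conj φ).map F = Formula.conj (fun i => (φ i).map F) := by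
  induction n with
  | zero => rfl
  | succ n ih => simp only [Formula.conj, Formula.map, ih]

/-- The conclusion is syntactic equality rather than provable equivalence; this is what later makes
the syntactic functors strictly inverse. -/
theorem map_map_of_comp_eq_id {F : L →ᴸ L'} {G : L' →ᴸ L}
    (h : G.comp F = FirstOrder.Language.LHom.id L) (φ : Formula L α) :
    (φ.map F).map G = φ := by
  have ht : ∀ {α : Type} (t : L.Term α), G.onTerm (F.onTerm t) = t := by
    intro α t
    have := congrFun (FirstOrder.Language.LHom.comp_onTerm (α := α) G F) t
    rw [h, FirstOrder.Language.LHom.id_onTerm] at this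
    exact this.symm
  have hr : ∀ {k : ℕ} (R : L.Relations k), G.onRelation (F.onRelation R) = R := fun {k} R =>
    congrArg (fun H : L →ᴸ L => H.onRelation R) h
  induction φ with
  | eq s t => simp only [Formula.map, ht]
  | rel R ts => simp only [Formula.map, ht, hr]
  | top => rfl
  | and φ ψ h1 h2 => simp only [Formula.map, h1, h2]
  | iSup φ h => simp only [Formula.map, h]
  | ex k φ h => simp only [Formula.map, h]

/-! ### Translation of proofs -/

variable {T : GeomTheory L} {T' : GeomTheory L'}

/-- The language map `F` sends the axioms of `T` to theorems of `T'`. -/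
def Interprets (T : GeomTheory L) (T' : GeomTheory L') (F : L →ᴸ L') : Prop :=
  ∀ S ∈ T, Prf T' [S.hyp.map F] (S.concl.map F)

/-- Each logical rule is carried to the same rule, since translation is structural. The hypothesis
on axioms enters only at `ax`, where the translated axiom is a theorem of `T'` that is then used at
the translated substitution. -/
theorem Prf.map {F : L →ᴸ L'} (hF : Interprets T T' F) {Γ : List (Formula L α)}
    {φ : Formula L α} (h : Prf T Γ φ) : Prf T' (Γ.map (Formula.map F)) (φ.map F) := by
  induction h with
  | hyp h => exact .hyp (List.mem_map_of_mem h)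
  | ax hS σ _ ih =>
    rw [map_subst] at ih ⊢
    exact (hF _ hS).use _ ih
  | topI => exact .topI
  | andI _ _ h1 h2 => exact .andI h1 h2
  | andL _ h => exact .andL h
  | andR _ h => exact .andR h
  | supI i _ h => exact .supI (φ := fun i => Formula.map F _) i h
  | supE _ _ h1 h2 => exact .supE h1 h2
  | exI ts _ h =>
    rw [map_inst] at h
    exact .exI _ h
  | @exE _ Γ k φ ψ _ _ h1 h2 =>
    refine .exE h1 ?_
    simpa only [List.map_cons, List.map_map, Function.comp_def, map_wk] using h2
  | eqI t => exact .eqI _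
  | eqE φ _ _ h1 h2 =>
    rw [map_inst] at h2 ⊢
    exact .eqE _ h1 h2

/-! ### The induced functor between syntactic categories -/

/-- Translation of a formula in context. -/
def SynCat.mapObj (T' : GeomTheory L') (F : L →ᴸ L') (X : SynCat T) : SynCat T' :=
  ⟨X.ctx, X.form.map F⟩

/-- Being provably functional is a list of provable sequents, and each of them translates. -/
theorem ProvablyFunctional.map {F : L →ᴸ L'} (hF : Interprets T T' F) {X Y : SynCat T}
    {θ : Formula L (Fin X.ctx ⊕ Fin Y.ctx)} (hθ : ProvablyFunctional X Y θ) :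
    ProvablyFunctional (X.mapObj T' F) (Y.mapObj T' F) (θ.map F) where
  dom := by
    have := hθ.dom.map hF
    rwa [map_subst] at this
  cod := by
    have := hθ.cod.map hF
    rwa [map_subst] at this
  total := hθ.total.map hF
  unique j := by
    have := (hθ.unique j).map hF
    simp only [List.map_cons, List.map_nil, map_subst, onTerm_elim] at this
    exact this

/-- Translation of a provably functional formula. -/
def FunForm.map {F : L →ᴸ L'} (hF : Interprets T T' F) {X Y : SynCat T} (θ : FunForm X Y) :
    FunForm (X.mapObj T' F) (Y.mapObj T' F) :=
  ⟨θ.1.map F, θ.2.map hF⟩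

/-- Functoriality of the translation holds already for representing formulas, before passing to
provable equivalence; the same is true of composites. -/
theorem map_idForm (F : L →ᴸ L') (X : SynCat T) :
    (idForm X).map F = idForm (X.mapObj T' F) := by
  simp only [idForm, Formula.map, map_subst, map_conj]
  rfl

theorem map_compForm (F : L →ᴸ L') {n m p : ℕ} (θ : Formula L (Fin n ⊕ Fin m))
    (η : Formula L (Fin m ⊕ Fin p)) :
    (compForm θ η).map F = compForm (θ.map F) (η.map F) := by
  simp only [compForm, Formula.map, map_subst, onTerm_elim]
  rfl

theorem map_imageForm (F : L →ᴸ L') {n m : ℕ} (θ : Formula L (Fin n ⊕ Fin m)) :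
    (imageForm θ).map F = imageForm (θ.map F) := by
  simp only [imageForm, Formula.map, map_subst, onTerm_elim]
  rfl

/-- The functor between syntactic categories induced by an interpretation. -/
def SynCat.mapFunctor {F : L →ᴸ L'} (hF : Interprets T T' F) : SynCat T ⥤ SynCat T' where
  obj X := X.mapObj T' F
  map f := Quotient.map (FunForm.map hF) (fun _ _ (h : Prf _ _ _ ∧ Prf _ _ _) => ⟨h.1.map hF, h.2.map hF⟩) f
  map_id X := congrArg (Quotient.mk _) (Subtype.ext (map_idForm F X))
  map_comp f g := by
    induction f using Quotient.ind with
    | _ θ =>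
      induction g using Quotient.ind with
      | _ η => exact congrArg (Quotient.mk _) (Subtype.ext (map_compForm F θ.1 η.1))

/-- After a round trip of translations, source and target equal the original ones only
propositionally, so morphisms must be compared heterogeneously. This reduces the comparison to the
underlying formulas. -/
theorem FunForm.hom_heq {X X' Y Y' : SynCat T} (hX : X = X') (hY : Y = Y')
    {θ : FunForm X Y} {θ' : FunForm X' Y'} (h : θ.1 ≍ θ'.1) : θ.hom ≍ θ'.hom := by
  subst hX hY
  exact heq_of_eq (congrArg FunForm.hom (Subtype.ext (eq_of_heq h)))

theorem SynCat.mapFunctor_comp_eq_id {F : L →ᴸ L'} {G : L' →ᴸ L} (hF : Interprets T T' F)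
    (hG : Interprets T' T G) (h : G.comp F = FirstOrder.Language.LHom.id L) :
    mapFunctor hF ⋙ mapFunctor hG = 𝟭 (SynCat T) := by
  have hobj : ∀ X : SynCat T, (X.mapObj T' F).mapObj T G = X := fun X =>
    congrArg (SynCat.mk X.ctx) (map_map_of_comp_eq_id h X.form)
  refine Functor.hext hobj ?_
  intro X Y f
  induction f using Quotient.ind with
  | _ θ => exact FunForm.hom_heq (hobj X) (hobj Y) (heq_of_eq (map_map_of_comp_eq_id h θ.1))

/-- Mutually inverse interpretations induce an equivalence of syntactic categories. -/
def SynCat.mapEquivalence {F : L →ᴸ L'} {G : L' →ᴸ L} (hF : Interprets T T' F)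
    (hG : Interprets T' T G) (h : G.comp F = FirstOrder.Language.LHom.id L)
    (h' : F.comp G = FirstOrder.Language.LHom.id L') : SynCat T ≌ SynCat T' :=
  .mk (mapFunctor hF) (mapFunctor hG) (eqToIso (mapFunctor_comp_eq_id hF hG h).symm)
    (eqToIso (mapFunctor_comp_eq_id hG hF h'))

/-- Covering is the provability of a single sequent, and translation commutes with disjunctions and
images. -/
theorem map_mem_synPrecoverage {F : L →ᴸ L'} (hF : Interprets T T' F) {X : SynCat T}
    {R : Presieve X} (hR : R ∈ synPrecoverage T X) :
    R.map (SynCat.mapFunctor hF) ∈ synPrecoverage T' ((SynCat.mapFunctor hF).obj X) := by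
  obtain ⟨ι, Z, θ, rfl, hp⟩ := hR
  refine ⟨ι, fun i => (Z i).mapObj T' F, fun i => (θ i).map hF, Presieve.map_ofArrows (fun i => (θ i).hom), ?_⟩
  have := hp.map hF
  simp only [List.map_cons, List.map_nil, Formula.map, map_imageForm] at this
  exact this

end Geometric

/-! ### Equivalences of sites presented by precoverages -/

namespace CategoryTheory

variable {C : Type*} [Category* C] {D : Type*} [Category* D]

/-- The sieves whose pushforward along an equivalence covers are those of the induced topology. The
topology generated by `J` is the least one containing its generators, so only the generators need
checking. -/
theorem Functor.functorPushforward_mem_of_map_mem {J : Precoverage C} {K : Precoverage D}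
    (F : C ⥤ D) [F.IsEquivalence]
    (hF : ∀ ⦃X : C⦄ (R : Presieve X), R ∈ J X → R.map F ∈ K (F.obj X)) {X : C} {S : Sieve X}
    (hS : S ∈ J.toGrothendieck X) : S.functorPushforward F ∈ K.toGrothendieck (F.obj X) := by
  have hle : J.toGrothendieck ≤ F.inducedTopology K.toGrothendieck := by
    rw [Precoverage.toGrothendieck_le_iff_le_toPrecoverage]
    intro X R hR
    change Sieve.generate R ∈ F.inducedTopology K.toGrothendieck X
    -- The pushforward of a generated sieve is generated by the image of its generators, which is
    -- where the hypothesis applies.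
    rw [Functor.mem_inducedTopology_iff_of_isCoverDense, ← Sieve.generate_map_eq_functorPushforward]
    exact Precoverage.generate_mem_toGrothendieck (hF R hR)
  exact (Functor.mem_inducedTopology_iff_of_isCoverDense _ _ _).1 (hle _ hS)

/-- Preservation of covers by the inverse is the previous lemma. Reflection comes from preservation
by the functor: transport the sieve back to `D` and correct by the counit. -/
theorem Equivalence.isDenseSubsite_inverse_of_map_mem {J : Precoverage C} {K : Precoverage D}
    (e : C ≌ D)
    (hF : ∀ ⦃X : C⦄ (R : Presieve X), R ∈ J X → R.map e.functor ∈ K (e.functor.obj X))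
    (hG : ∀ ⦃Y : D⦄ (R : Presieve Y), R ∈ K Y → R.map e.inverse ∈ J (e.inverse.obj Y)) :
    e.inverse.IsDenseSubsite K.toGrothendieck J.toGrothendieck where
  functorPushforward_mem_iff {Y S} := by
    refine ⟨fun h => ?_, e.inverse.functorPushforward_mem_of_map_mem hG⟩
    have h1 := e.functor.functorPushforward_mem_of_map_mem hF h
    have h2 := K.toGrothendieck.pullback_stable (e.counitInv.app Y) h1
    refine K.toGrothendieck.superset_covering ?_ h2
    -- The pulled-back sieve is contained in `S`: by naturality of the counit, each of its arrows
    -- `f` factors through some `a` in `S`.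
    rintro Z f ⟨W, g, k, ⟨V, a, b, ha, rfl⟩, hk⟩
    have : f = (k ≫ e.functor.map b ≫ e.counit.app V) ≫ a := by
      have := congrArg (· ≫ e.counit.app Y) hk
      simpa using this
    rw [this]
    exact S.downward_closed ha _

end CategoryTheory

namespace Geometric

/-- Mutually inverse interpretations induce an equivalence of classifying toposes. -/
theorem nonempty_classifyingTopos_equivalence {L L' : FirstOrder.Language.{u, u}}
    {T : GeomTheory L} {T' : GeomTheory L'} {F : L →ᴸ L'} {G : L' →ᴸ L}
    (hF : Interprets T T' F) (hG : Interprets T' T G)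
    (h : G.comp F = FirstOrder.Language.LHom.id L)
    (h' : F.comp G = FirstOrder.Language.LHom.id L') :
    Nonempty (ClassifyingTopos T ≌ ClassifyingTopos T') := by
  have : (SynCat.mapEquivalence hF hG h h').inverse.IsDenseSubsite (synTopology T')
      (synTopology T) :=
    (SynCat.mapEquivalence hF hG h h').isDenseSubsite_inverse_of_map_mem
      (fun _ _ hR => map_mem_synPrecoverage hF hR) (fun _ _ hR => map_mem_synPrecoverage hG hR)
  exact ⟨(SynCat.mapEquivalence hF hG h h').sheafCongr (synTopology T) (synTopology T') (Type u)⟩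

end Geometric

namespace RTS

open Geometric

variable {M N : RTS.{u}}

/-! ### Simulations and path equivalence -/

theorem Simulation.reach (f : Simulation M N) {s t : M.State} (h : M.Reach s t) :
    N.Reach (f.toFun s) (f.toFun t) :=
  Relation.ReflTransGen.lift f.toFun (fun _ _ h => f.map_step h) _ _ h

/-- Test the definition on the two states themselves and use reflexivity; the converse is
transitivity. -/
theorem pathEquiv_iff {s t : M.State} : M.PathEquiv s t ↔ M.Reach s t ∧ M.Reach t s :=
  ⟨fun h => ⟨(h t).1.2 .refl, (h s).1.1 .refl⟩, fun h _ =>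
    ⟨⟨h.2.trans, h.1.trans⟩, ⟨fun hw => hw.trans h.1, fun hw => hw.trans h.2⟩⟩⟩

/-- The definition quantifies over all states of `N`, including those outside the image of `f`;
mutual reachability avoids them. -/
theorem Simulation.pathEquiv (f : Simulation M N) {s t : M.State} (h : M.PathEquiv s t) :
    N.PathEquiv (f.toFun s) (f.toFun t) :=
  pathEquiv_iff.2 ⟨f.reach (pathEquiv_iff.1 h).1, f.reach (pathEquiv_iff.1 h).2⟩

/-- The simulation induced on path-equivalence quotients. -/
def Simulation.quotientMap (f : Simulation M N) : Simulation M.quotient N.quotient where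
  toFun := Quotient.map f.toFun (fun _ _ h => f.pathEquiv h)
  map_step := by
    rintro _ _ ⟨s, t, rfl, rfl, h⟩
    exact ⟨f.toFun s, f.toFun t, rfl, rfl, f.map_step h⟩
  map_init := congrArg (Quotient.mk N.pathSetoid) f.map_init

/-- A functional bisimulation induces an isomorphism of path-equivalence quotients. -/
def FunctionalBisimulation.quotientIso (b : FunctionalBisimulation M N) :
    M.quotient ≅ N.quotient where
  hom := b.f.quotientMap
  inv := b.g.quotientMap
  hom_inv_id := Simulation.ext (funext fun q => Quotient.inductionOn q fun s =>
    Quotient.sound (s := M.pathSetoid) (b.gf s))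
  inv_hom_id := Simulation.ext (funext fun q => Quotient.inductionOn q fun t =>
    Quotient.sound (s := N.pathSetoid) (b.fg t))

/-! ### Isomorphic systems have equivalent classifying toposes -/

/-- The language map renaming the constants along a map of states. -/
def langMap (f : M.State → N.State) : M.lang →ᴸ N.lang where
  onFunction := fun {_} c => match c with
    | .const s => .const (f s)
  onRelation := fun {_} R => R

theorem langMap_comp_eq_id {f : M.State → N.State} {g : N.State → M.State}
    (h : ∀ s, g (f s) = s) : (langMap g).comp (langMap f) = FirstOrder.Language.LHom.id M.lang := by
  refine FirstOrder.Language.LHom.funext ?_ rfl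
  funext n c
  cases c with
  | const s => exact congrArg FuncSym.const (h s)

/-! ### Renaming constants in the axioms of the theory -/

variable {α : Type} (f : M.State → N.State)

/-- The two sides may differ only in their empty tuples of arguments. -/
theorem langMap_cst (s : M.State) :
    (langMap f).onTerm (cst s : M.lang.Term α) = cst (f s) :=
  congrArg (FirstOrder.Language.Term.func (L := N.lang) (l := 0) (FuncSym.const (f s)))
    (Subsingleton.elim _ _)

theorem map_binary (R : RelSym.{u} 2) (x y : M.lang.Term α) :
    (Formula.rel (L := M.lang) (k := 2) R ![x, y]).map (langMap f) =
      .rel (L := N.lang) (k := 2) R ![(langMap f).onTerm x, (langMap f).onTerm y] :=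
  congrArg (Formula.rel (L := N.lang) (k := 2) R) (by funext i; fin_cases i <;> rfl)

theorem map_Δ (x y : M.lang.Term α) :
    (Δ x y).map (langMap f) = Δ ((langMap f).onTerm x) ((langMap f).onTerm y) :=
  map_binary f _ x y

theorem map_Γ (x y : M.lang.Term α) :
    (Γ x y).map (langMap f) = Γ ((langMap f).onTerm x) ((langMap f).onTerm y) :=
  map_binary f _ x y

theorem map_Θ (x y : M.lang.Term α) :
    (Θ x y).map (langMap f) = Θ ((langMap f).onTerm x) ((langMap f).onTerm y) :=
  map_binary f _ x y

theorem ThClause.prf {S : Sequent M.lang} (h : M.ThClause S) :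
    Prf M.theory [S.hyp] S.concl := by
  have := Prf.ax (T := M.theory) (Γ := [S.hyp]) h v (by
    rw [subst_v]; exact .hyp List.mem_cons_self)
  rwa [subst_v] at this

/-- The structural sequents contain no constants and translate to themselves. Existence uses that
the isomorphism preserves steps. The negative axioms use that its inverse preserves reachability and
path equivalence. Completeness and domain closure use the inverse to name preimages of states of
`N`. -/
theorem interprets_of_iso (i : M ≅ N) :
    Interprets M.theory N.theory (langMap (Simulation.toFun i.hom)) := by
  have hgf : ∀ s, Simulation.toFun i.inv (Simulation.toFun i.hom s) = s := fun s =>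
    congrFun (congrArg Simulation.toFun i.hom_inv_id) s
  have hfg : ∀ t, Simulation.toFun i.hom (Simulation.toFun i.inv t) = t := fun t =>
    congrFun (congrArg Simulation.toFun i.inv_hom_id) t
  intro S hS
  cases hS with
  | step_reach => simp only [map_Δ, map_Γ]; exact ThClause.step_reach.prf
  | reach_refl => simp only [map_Γ]; exact ThClause.reach_refl.prf
  | reach_trans => simp only [Formula.map, map_Γ]; exact ThClause.reach_trans.prf
  | pathEq_def => simp only [Formula.map, map_Γ, map_Θ]; exact ThClause.pathEq_def.prf
  | pathEq_symm => simp only [map_Θ]; exact ThClause.pathEq_symm.prf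
  | pathEq_reach => simp only [map_Γ, map_Θ]; exact ThClause.pathEq_reach.prf
  | existence s t h =>
    simp only [map_Δ, langMap_cst]
    exact (ThClause.existence _ _ (Simulation.map_step i.hom h)).prf
  | completeness s =>
    simp only [Formula.map, map_Δ, langMap_cst]
    refine .supE (ThClause.completeness (Simulation.toFun i.hom s)).prf ?_
    -- A successor `t` of the image of `s` is the image of a successor of `s`, so it occurs in the
    -- translated disjunction.
    rintro ⟨t, ht⟩
    have hs : M.Step s (Simulation.toFun i.inv t) := by
      have := Simulation.map_step i.inv ht
      rwa [hgf] at this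
    refine .supI ⟨Simulation.toFun i.inv t, hs⟩ ?_
    rw [hfg]
    exact .hyp List.mem_cons_self
  | not_reach s t h =>
    simp only [map_Γ, langMap_cst]
    -- The translation of falsity is again an empty disjunction but not literally `bot`, so it is
    -- derived by eliminating `bot`.
    refine .supE (ThClause.not_reach _ _ fun hr => h ?_).prf (fun i => i.elim)
    have := Simulation.reach i.inv hr
    rwa [hgf, hgf] at this
  | not_pathEq s t h =>
    simp only [map_Θ, langMap_cst]
    refine .supE (ThClause.not_pathEq _ _ fun hr => h ?_).prf (fun i => i.elim)
    have := Simulation.pathEquiv i.inv hr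
    rwa [hgf, hgf] at this
  | domain_closure =>
    simp only [Formula.map, langMap_cst]
    refine .supE ThClause.domain_closure.prf fun t => .supI (Simulation.toFun i.inv t) ?_
    rw [hfg]
    exact .hyp List.mem_cons_self

theorem nonempty_classifyingTopos_equivalence_of_iso (i : M ≅ N) :
    Nonempty (ClassifyingTopos M.theory ≌ ClassifyingTopos N.theory) :=
  nonempty_classifyingTopos_equivalence (interprets_of_iso i) (interprets_of_iso i.symm)
    (langMap_comp_eq_id fun s => congrFun (congrArg Simulation.toFun i.hom_inv_id) s)
    (langMap_comp_eq_id fun t => congrFun (congrArg Simulation.toFun i.inv_hom_id) t)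

end RTS

theorem mainTheorem12 (M N : RTS.{u}) (h : RTS.FunctionallyBisimilar M N) :
    Nonempty (M.quotient ≅ N.quotient) ∧
      Nonempty (Geometric.ClassifyingTopos M.quotient.theory ≌
        Geometric.ClassifyingTopos N.quotient.theory) := by
  obtain ⟨b⟩ := h
  exact ⟨⟨b.quotientIso⟩, RTS.nonempty_classifyingTopos_equivalence_of_iso b.quotientIso⟩
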